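/- Let $d, K_0, K_1 \ge 1$ be integers, let $\pi_0=(\pi_0^k)_{k\le K_0}$ and $\pi_1=(\pi_1^k)_{k\le K_1}$ be vectors of non-negative weights, each summing to $1$, let $m_0^1,\dots,m_0^{K_0}, m_1^1,\dots,m_1^{K_1}\in\mathbb{R}^d$, and let $\Sigma_0^1,\dots,\Sigma_0^{K_0}$ be symmetric positive semidefinite real $d\times d$ matrices. Put $$\mu_0=\sum_{k=1}^{K_0}\pi_0^k\,\mathcal N(m_0^k,\Sigma_0^k),\qquad \tilde\mu_0=\sum_{k=1}^{K_0}\pi_0^k\,\delta_{m_0^k},\qquad \mu_1=\sum_{k=1}^{K_1}\pi_1^k\,\delta_{m_1^k}.$$ For probability measures $\mu,\nu$ on $\mathbb{R}^d$ let $\Pi(\mu,\nu)$ be the set of probability measures on $\mathbb{R}^d\times\mathbb{R}^d$ with marginals $\mu$ and $\nu$, let $GMM_{2d}(\infty)$ be the set of finite mixtures (convex combinations) of possibly degenerate Gaussian measures on $\mathbb{R}^d\times\mathbb{R}^d=\mathbb{R}^{2d}$, and define, with the Euclidean norm, $$W_2^2(\mu,\nu)=\inf_{\gamma\in\Pi(\mu,\nu)}\int\|x-y\|^2\,d\gamma(x,y),\qquad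 MW_2^2(\mu,\nu)=\inf_{\gamma\in\Pi(\mu,\nu)\cap GMM_{2d}(\infty)}\int\|x-y\|^2\,d\gamma(x,y).$$ Then both $W_2^2(\tilde\mu_0,\mu_1)$ and $MW_2^2(\mu_0,\mu_1)$ are finite, and $$MW_2^2(\mu_0,\mu_1)=W_2^2(\tilde\mu_0,\mu_1)+\sum_{k=1}^{K_0}\pi_0^k\,\mathrm{tr}(\Sigma_0^k).$$ -/

import Mathlib

open MeasureTheory ProbabilityTheory
open scoped ENNReal

namespace GMMTransport

/-- The finite mixture `∑ₖ πₖ νₖ` of measures with real weights `πₖ`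
(used only for `π` in the standard simplex). -/
noncomputable def mixture {E : Type*} [MeasurableSpace E] {K : ℕ}
    (π : Fin K → ℝ) (ν : Fin K → Measure E) : Measure E :=
  ∑ k, ENNReal.ofReal (π k) • ν k

/-- Finite Gaussian mixtures: convex combinations of finitely many Gaussian measures, which may be
degenerate. On a finite-dimensional space `IsGaussian` describes exactly the laws `𝒩(m, Σ)`
with `Σ` positive semidefinite. -/
def IsGaussianMixture {E : Type*} [TopologicalSpace E] [AddCommMonoid E] [Module ℝ E]
    [MeasurableSpace E] (μ : Measure E) : Prop :=
  ∃ (K : ℕ) (π : Fin K → ℝ) (ν : Fin K → Measure E),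
    π ∈ stdSimplex ℝ (Fin K) ∧ (∀ k, IsGaussian (ν k)) ∧ μ = mixture π ν

/-- The transport plans `Π(μ, ν)`: measures on the product with marginals `μ` and `ν`
(probability measures whenever `μ` is one). -/
def couplings {E : Type*} [MeasurableSpace E] (μ ν : Measure E) : Set (Measure (E × E)) :=
  {γ | γ.map Prod.fst = μ ∧ γ.map Prod.snd = ν}

/-- The quadratic cost `∫ ‖x - y‖² dγ(x, y)` of a plan, in `[0, ∞]`. -/
noncomputable def quadCost {E : Type*} [NormedAddCommGroup E] [MeasurableSpace E]
    (γ : Measure (E × E)) : ℝ≥0∞ :=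
  ∫⁻ p, ‖p.1 - p.2‖ₑ ^ 2 ∂γ

/-- The squared Wasserstein distance `W₂²`. -/
noncomputable def W2sq {E : Type*} [NormedAddCommGroup E] [MeasurableSpace E]
    (μ ν : Measure E) : ℝ≥0∞ :=
  ⨅ γ ∈ couplings μ ν, quadCost γ

/-- The squared mixture Wasserstein distance `MW₂²`: the infimum of the quadratic cost over the
plans that are finite Gaussian mixtures on the product space. -/
noncomputable def MW2sq {E : Type*} [NormedAddCommGroup E] [NormedSpace ℝ E] [MeasurableSpace E]
    (μ ν : Measure E) : ℝ≥0∞ :=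
  ⨅ γ ∈ {γ | γ ∈ couplings μ ν ∧ IsGaussianMixture γ}, quadCost γ

end GMMTransport

/-!
Along a continuous linear functional, the moment generating function of a Gaussian mixture is a
combination of functions `exp (a s + b s² / 2)`. Their growth rates at `+∞` are all distinct, so
they are linearly independent, and a Gaussian mixture determines the mixture of the Dirac masses at
the means of its components.

Hence, replacing every component of a Gaussian mixture plan by the Dirac mass at its mean yields a
plan between the laws of the means. If the second marginal of the plan is finitely supported, then
so is that of each component; being Gaussian, it is a Dirac mass, and Steiner's formula shows that
the replacement lowers the cost by the total variance of the first marginal of the component.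
These losses add up to a quantity that only depends on the first marginal `μ₀` of the plan: the
difference between the second moments of `μ₀` and of its law of means.

Conversely, a plan starting at `∑ₖ πₖ δ_{mₖ}` disintegrates as `∑ₖ πₖ δ_{mₖ} ⊗ κₖ`, and replacing
`δ_{mₖ}` by a Gaussian measure of mean `mₖ` raises the cost by the same quantity. The new plan is a
Gaussian mixture because the `κₖ` are finitely supported.
-/

namespace GMMTransport

open Filter Asymptotics

lemma linearIndependent_of_isLittleO {ι α 𝕜 : Type*} [LinearOrder ι] [NormedField 𝕜]
    {l : Filter α} {f : ι → α → 𝕜} (hf : ∀ i, ∃ᶠ x in l, f i x ≠ 0)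
    (h : ∀ i j, i < j → f i =o[l] f j) : LinearIndependent 𝕜 f := by
  classical
  rw [linearIndependent_iff']
  intro s c hs
  by_contra! ⟨i₀, hi₀, hci₀⟩
  set T := s.filter (c · ≠ 0)
  have hT : T.Nonempty := ⟨i₀, Finset.mem_filter.2 ⟨hi₀, hci₀⟩⟩
  set m := T.max' hT
  have hm : m ∈ T := T.max'_mem hT
  have hcm : c m ≠ 0 := (Finset.mem_filter.1 hm).2
  have hlower : (∑ i ∈ T.erase m, c i • f i) =o[l] f m := by
    refine IsLittleO.sum fun i hi ↦ (h i m ?_).const_mul_left (c i)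
    exact (T.le_max' i (Finset.mem_of_mem_erase hi)).lt_of_ne (Finset.ne_of_mem_erase hi)
  have hsum : c m • f m + ∑ i ∈ T.erase m, c i • f i = 0 := by
    rw [Finset.add_sum_erase T (fun i ↦ c i • f i) hm, ← hs, Finset.sum_filter_of_ne]
    exact fun i _ hi hc ↦ hi (by rw [hc, zero_smul])
  have hself : (c m • f m) =o[l] f m := by
    rw [eq_neg_of_add_eq_zero_left hsum]
    exact hlower.neg_left
  exact isLittleO_irrefl (hf m) ((isLittleO_const_mul_left_iff hcm).1 hself)

/-- The exponential with exponent `a s + b s² / 2` is the moment generating function of the real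
Gaussian law of mean `a` and variance `b`; listing `b` first makes the lexicographic order on the
parameters the order of growth. -/
noncomputable def gaussianMGF (p : ℝ ×ₗ ℝ) (s : ℝ) : ℝ :=
  Real.exp ((ofLex p).2 * s + (ofLex p).1 * s ^ 2 / 2)

lemma gaussianMGF_isLittleO {p q : ℝ ×ₗ ℝ} (hpq : p < q) :
    gaussianMGF p =o[atTop] gaussianMGF q := by
  refine Real.isLittleO_exp_comp_exp_comp.2 ?_
  rcases Prod.Lex.lt_iff.1 hpq with hvar | ⟨hvar, hmean⟩
  · have hlinear : Tendsto (fun s : ℝ ↦ ((ofLex q).2 - (ofLex p).2) +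
        ((ofLex q).1 - (ofLex p).1) / 2 * s) atTop atTop :=
      tendsto_atTop_add_const_left _ _ (tendsto_id.const_mul_atTop (by linarith))
    exact (tendsto_id.atTop_mul_atTop₀ hlinear).congr fun s ↦ by simp only [id]; ring
  · have hlinear : Tendsto (fun s : ℝ ↦ ((ofLex q).2 - (ofLex p).2) * s) atTop atTop :=
      tendsto_id.const_mul_atTop (by linarith)
    exact hlinear.congr fun s ↦ by rw [hvar]; ring

lemma linearIndependent_gaussianMGF : LinearIndependent ℝ gaussianMGF :=
  linearIndependent_of_isLittleO (l := atTop)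
    (fun _ ↦ (Eventually.of_forall fun _ ↦ (Real.exp_pos _).ne').frequently)
    fun _ _ ↦ gaussianMGF_isLittleO

lemma sum_smul_comp_eq_of_linearIndependent {R M V α ι κ : Type*} [Semiring R]
    [AddCommMonoid M] [Module R M] [AddCommMonoid V] [Module R V] [Fintype ι] [Fintype κ]
    {v : α → M} (hv : LinearIndependent R v) {c : ι → R} {a : ι → α} {c' : κ → R} {a' : κ → α}
    (h : ∑ i, c i • v (a i) = ∑ j, c' j • v (a' j)) (φ : α → V) :
    ∑ i, c i • φ (a i) = ∑ j, c' j • φ (a' j) := by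
  have hcoeff : ∑ i, Finsupp.single (a i) (c i) = ∑ j, Finsupp.single (a' j) (c' j) :=
    hv (by simpa only [map_sum, Finsupp.linearCombination_single] using h)
  simpa only [map_sum, Finsupp.linearCombination_single] using
    congrArg (Finsupp.linearCombination R φ) hcoeff

section Mixture

variable {E F : Type*} [MeasurableSpace E] [MeasurableSpace F] {K : ℕ}

lemma lintegral_mixture (π : Fin K → ℝ) (ν : Fin K → Measure E) (f : E → ℝ≥0∞) :
    ∫⁻ x, f x ∂(mixture π ν) = ∑ k, ENNReal.ofReal (π k) * ∫⁻ x, f x ∂(ν k) := by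
  simp only [mixture, lintegral_finsetSum_measure, lintegral_smul_measure, smul_eq_mul]

lemma integral_mixture {G : Type*} [NormedAddCommGroup G] [NormedSpace ℝ G] {π : Fin K → ℝ}
    (hπ : ∀ k, 0 ≤ π k) {ν : Fin K → Measure E} {f : E → G} (hf : ∀ k, Integrable f (ν k)) :
    ∫ x, f x ∂(mixture π ν) = ∑ k, π k • ∫ x, f x ∂(ν k) := by
  rw [mixture, integral_finsetSum_measure fun k _ ↦ (hf k).smul_measure ENNReal.ofReal_ne_top]
  simp only [integral_smul_measure, ENNReal.toReal_ofReal (hπ _)]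

lemma map_mixture (π : Fin K → ℝ) (ν : Fin K → Measure E) {f : E → F} (hf : Measurable f) :
    (mixture π ν).map f = mixture π fun k ↦ (ν k).map f := by
  simp only [mixture, Measure.map_finset_sum hf.aemeasurable, Measure.map_smul]

lemma ae_mixture_iff {π : Fin K → ℝ} {ν : Fin K → Measure E} {p : E → Prop} :
    (∀ᵐ x ∂(mixture π ν), p x) ↔ ∀ k, 0 < π k → ∀ᵐ x ∂(ν k), p x := by
  rw [mixture, ae_finsetSum_measure_iff]
  refine ⟨fun h k hk ↦ ?_, fun h k _ ↦ ?_⟩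
  · exact (Measure.ae_ennreal_smul_measure_iff (ENNReal.ofReal_pos.2 hk).ne').1
      (h k (Finset.mem_univ k))
  · rcases lt_or_ge 0 (π k) with hk | hk
    · exact Measure.ae_smul_measure (h k hk) _
    · simp [ENNReal.ofReal_of_nonpos hk]

instance isFiniteMeasure_mixture (π : Fin K → ℝ) (ν : Fin K → Measure E)
    [∀ k, IsFiniteMeasure (ν k)] : IsFiniteMeasure (mixture π ν) where
  measure_univ_lt_top := by
    simp [mixture, ENNReal.sum_lt_top, ENNReal.mul_lt_top, measure_lt_top]

lemma isProbabilityMeasure_mixture {π : Fin K → ℝ} (hπ : π ∈ stdSimplex ℝ (Fin K))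
    (ν : Fin K → Measure E) [∀ k, IsProbabilityMeasure (ν k)] :
    IsProbabilityMeasure (mixture π ν) where
  measure_univ := by
    simp [mixture, ← ENNReal.ofReal_sum_of_nonneg fun k _ ↦ hπ.1 k, hπ.2]

end Mixture

section Identifiability

variable {E : Type*} [NormedAddCommGroup E] [NormedSpace ℝ E] [MeasurableSpace E] {K K' : ℕ}

lemma mgf_dual_eq_gaussianMGF (ν : Measure E) [IsGaussian ν] (L : StrongDual ℝ E) :
    mgf L ν = gaussianMGF (toLex (Var[L; ν], ν[L])) := by
  funext s
  rw [mgf_gaussianReal (IsGaussian.map_eq_gaussianReal L),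
    Real.coe_toNNReal _ (variance_nonneg _ _)]
  rfl

variable [BorelSpace E]

lemma integrable_exp_mul_dual (ν : Measure E) [IsGaussian ν] (L : StrongDual ℝ E) (s : ℝ) :
    Integrable (fun x ↦ Real.exp (s * L x)) ν := by
  have h := integrable_exp_mul_gaussianReal (μ := ν[L]) (v := Var[L; ν].toNNReal) s
  rw [← IsGaussian.map_eq_gaussianReal L] at h
  exact h.comp_measurable (by fun_prop)

lemma mgf_dual_mixture {π : Fin K → ℝ} (hπ : ∀ k, 0 ≤ π k) (ν : Fin K → Measure E)
    [∀ k, IsGaussian (ν k)] (L : StrongDual ℝ E) :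
    mgf L (mixture π ν) = ∑ k, π k • gaussianMGF (toLex (Var[L; ν k], (ν k)[L])) := by
  funext s
  simp only [← mgf_dual_eq_gaussianMGF, Finset.sum_apply, Pi.smul_apply]
  exact integral_mixture hπ fun k ↦ integrable_exp_mul_dual (ν k) L s

lemma charFunDual_mixture {π : Fin K → ℝ} (hπ : ∀ k, 0 ≤ π k) (ν : Fin K → Measure E)
    [∀ k, IsFiniteMeasure (ν k)] (L : StrongDual ℝ E) :
    charFunDual (mixture π ν) L = ∑ k, π k • charFunDual (ν k) L := by
  simp only [charFunDual_apply]
  refine integral_mixture hπ fun k ↦ (integrable_const (1 : ℝ)).mono (by fun_prop) ?_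
  exact ae_of_all _ fun x ↦ by simp [Complex.norm_exp_ofReal_mul_I]

variable [CompleteSpace E] [SecondCountableTopology E]

theorem mixture_dirac_mean_eq_of_mixture_eq {π : Fin K → ℝ} (hπ : ∀ k, 0 ≤ π k)
    {ν : Fin K → Measure E} [∀ k, IsGaussian (ν k)] {π' : Fin K' → ℝ} (hπ' : ∀ k, 0 ≤ π' k)
    {ν' : Fin K' → Measure E} [∀ k, IsGaussian (ν' k)] (h : mixture π ν = mixture π' ν') :
    mixture π (fun k ↦ Measure.dirac (∫ x, x ∂(ν k))) =
      mixture π' fun k ↦ Measure.dirac (∫ x, x ∂(ν' k)) := by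
  refine Measure.ext_of_charFunDual (funext fun L ↦ ?_)
  have hmgf : ∑ k, π k • gaussianMGF (toLex (Var[L; ν k], (ν k)[L])) =
      ∑ k, π' k • gaussianMGF (toLex (Var[L; ν' k], (ν' k)[L])) := by
    rw [← mgf_dual_mixture hπ, ← mgf_dual_mixture hπ', h]
  -- The weight of each pair (variance, mean) being determined, we may forget the variances.
  have hchar := sum_smul_comp_eq_of_linearIndependent linearIndependent_gaussianMGF hmgf
    fun p ↦ Complex.exp ((ofLex p).2 * Complex.I)
  simpa only [charFunDual_mixture hπ, charFunDual_mixture hπ', charFunDual_dirac,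
    IsGaussian.integral_dual, ofLex_toLex] using hchar

lemma eq_dirac_mean_of_ae_mem_countable (μ : Measure E) [IsGaussian μ] {s : Set E}
    (hs : s.Countable) (hμ : ∀ᵐ x ∂μ, x ∈ s) : μ = Measure.dirac (∫ x, x ∂μ) := by
  obtain ⟨x, hx⟩ : ∃ x, μ = Measure.dirac x := by
    by_contra! hne
    have := IsGaussian.nullSingletonClass hne
    obtain ⟨x, hx, hx'⟩ := (hμ.and (hs.ae_notMem μ)).exists
    exact hx' hx
  rw [hx, integral_dirac]

lemma mixture_dirac_mean_mem_couplings {K₀ K₁ : ℕ} {π : Fin K → ℝ} (hπ : ∀ k, 0 ≤ π k)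
    {ν : Fin K → Measure (E × E)} [∀ k, IsGaussian (ν k)] {π₀ : Fin K₀ → ℝ} (hπ₀ : ∀ k, 0 ≤ π₀ k)
    {ν₀ : Fin K₀ → Measure E} [∀ k, IsGaussian (ν₀ k)] {π₁ : Fin K₁ → ℝ} (hπ₁ : ∀ k, 0 ≤ π₁ k)
    {ν₁ : Fin K₁ → Measure E} [∀ k, IsGaussian (ν₁ k)]
    (h : mixture π ν ∈ couplings (mixture π₀ ν₀) (mixture π₁ ν₁)) :
    mixture π (fun k ↦ Measure.dirac (∫ p, p ∂(ν k))) ∈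
      couplings (mixture π₀ fun k ↦ Measure.dirac (∫ x, x ∂(ν₀ k)))
        (mixture π₁ fun k ↦ Measure.dirac (∫ y, y ∂(ν₁ k))) := by
  have hmarginal (P : E × E →L[ℝ] E) {J : ℕ} {ρ : Fin J → ℝ} (hρ : ∀ j, 0 ≤ ρ j)
      {η : Fin J → Measure E} [∀ j, IsGaussian (η j)] (hP : (mixture π ν).map P = mixture ρ η) :
      (mixture π fun k ↦ Measure.dirac (∫ p, p ∂(ν k))).map P =
        mixture ρ fun j ↦ Measure.dirac (∫ x, x ∂(η j)) := by
    rw [map_mixture _ _ (by fun_prop)] at hP ⊢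
    rw [← mixture_dirac_mean_eq_of_mixture_eq hπ hρ hP]
    simp only [P.integral_id_map IsGaussian.integrable_fun_id, Measure.map_dirac' P.measurable]
  exact ⟨hmarginal (.fst ℝ E E) hπ₀ h.1, hmarginal (.snd ℝ E E) hπ₁ h.2⟩

end Identifiability

section GaussianMixture

variable {E F : Type*} [NormedAddCommGroup E] [NormedSpace ℝ E] [MeasurableSpace E]
  [NormedAddCommGroup F] [NormedSpace ℝ F] [MeasurableSpace F]

lemma isGaussianMixture_sum_smul {ι : Type*} [Fintype ι] {c : ι → ℝ≥0∞} (hc : ∑ i, c i = 1)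
    (ν : ι → Measure E) [∀ i, IsGaussian (ν i)] : IsGaussianMixture (∑ i, c i • ν i) := by
  have hfin (i : ι) : c i ≠ ∞ :=
    ENNReal.sum_ne_top.1 (hc ▸ ENNReal.one_ne_top) i (Finset.mem_univ i)
  let e := (Fintype.equivFin ι).symm
  refine ⟨_, fun j ↦ (c (e j)).toReal, fun j ↦ ν (e j),
    ⟨fun _ ↦ ENNReal.toReal_nonneg, ?_⟩, fun _ ↦ inferInstance, ?_⟩
  · rw [e.sum_comp fun i ↦ (c i).toReal, ← ENNReal.toReal_sum fun i _ ↦ hfin i, hc,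
      ENNReal.toReal_one]
  · simp only [mixture, ENNReal.ofReal_toReal (hfin _)]
    exact (e.sum_comp fun i ↦ c i • ν i).symm

lemma isGaussianMixture_mixture_prod [BorelSpace E] [BorelSpace F]
    [SecondCountableTopologyEither E F] {K : ℕ} {π : Fin K → ℝ} (hπ : π ∈ stdSimplex ℝ (Fin K))
    (ν : Fin K → Measure E) [∀ k, IsGaussian (ν k)]
    (κ : Fin K → Measure F) [∀ k, IsProbabilityMeasure (κ k)] {s : Finset F}
    (hs : ∀ᵐ y ∂(mixture π κ), y ∈ s) :
    IsGaussianMixture (mixture π fun k ↦ (ν k).prod (κ k)) := by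
  have hκ (k : Fin K) (hk : 0 < π k) : κ k = ∑ y : s, κ k {y.1} • Measure.dirac y.1 := by
    rw [Finset.sum_coe_sort s fun y ↦ κ k {y} • Measure.dirac y]
    exact Measure.ae_mem_finset_iff.1 (ae_mixture_iff.1 hs k hk)
  let c (i : Fin K × s) : ℝ≥0∞ := ENNReal.ofReal (π i.1) * κ i.1 {i.2.1}
  have hmix : mixture π (fun k ↦ (ν k).prod (κ k)) =
      ∑ i : Fin K × s, c i • (ν i.1).prod (Measure.dirac i.2.1) := by
    rw [Fintype.sum_prod_type]
    refine Finset.sum_congr rfl fun k _ ↦ ?_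
    rcases (hπ.1 k).eq_or_lt with hk | hk
    · simp [c, ← hk]
    · change _ • (ν k).prod (κ k) = _
      rw [hκ k hk, ← Measure.sum_fintype, Measure.prod_sum_right, Measure.sum_fintype,
        Finset.smul_sum]
      simp only [c, Measure.prod_smul_right, smul_smul]
  have := isProbabilityMeasure_mixture hπ fun k ↦ (ν k).prod (κ k)
  have hc : ∑ i, c i = 1 := by
    have h := measure_univ (μ := mixture π fun k ↦ (ν k).prod (κ k))
    rw [hmix] at h
    simpa using h
  rw [hmix]
  exact isGaussianMixture_sum_smul hc _

end GaussianMixture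

lemma exists_eq_mixture_dirac_prod {E F : Type*} [MeasurableSpace E] [MeasurableSpace F]
    [StandardBorelSpace F] [Nonempty F] {K : ℕ} {π : Fin K → ℝ} {m : Fin K → E}
    {γ : Measure (E × F)} [IsFiniteMeasure γ]
    (hγ : γ.map Prod.fst = mixture π fun k ↦ Measure.dirac (m k)) :
    ∃ κ : Fin K → Measure F, (∀ k, IsProbabilityMeasure (κ k)) ∧
      γ = mixture π fun k ↦ (Measure.dirac (m k)).prod (κ k) := by
  refine ⟨fun k ↦ γ.condKernel (m k), fun k ↦ inferInstance, ?_⟩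
  ext s hs
  nth_rw 1 [← γ.disintegrate γ.condKernel]
  rw [Measure.compProd_apply hs, Measure.fst, hγ, lintegral_mixture]
  simp [mixture, lintegral_dirac' _ (Kernel.measurable_kernel_prodMk_left hs), Measure.dirac_prod,
    Measure.map_apply measurable_prodMk_left hs]

lemma ofReal_integral_norm_sq {α G : Type*} [MeasurableSpace α] [NormedAddCommGroup G]
    {μ : Measure α} {f : α → G} (hf : MemLp f 2 μ) :
    ENNReal.ofReal (∫ x, ‖f x‖ ^ 2 ∂μ) = ∫⁻ x, ‖f x‖ₑ ^ 2 ∂μ := by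
  rw [ofReal_integral_eq_lintegral_ofReal hf.norm.integrable_sq (ae_of_all _ fun _ ↦ sq_nonneg _)]
  simp only [ENNReal.ofReal_pow (norm_nonneg _), ofReal_norm]

section Cost

variable {E : Type*} [NormedAddCommGroup E] [MeasurableSpace E]

lemma quadCost_mixture {K : ℕ} (π : Fin K → ℝ) (ν : Fin K → Measure (E × E)) :
    quadCost (mixture π ν) = ∑ k, ENNReal.ofReal (π k) * quadCost (ν k) :=
  lintegral_mixture _ _ _

/-- The total variance `∫ ‖x - m‖² dμ(x)` of a measure with mean `m`, i.e. the trace of its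
covariance operator, with values in `[0, ∞]`. -/
noncomputable def totalVariance [NormedSpace ℝ E] (μ : Measure E) : ℝ≥0∞ :=
  ∫⁻ x, ‖x - ∫ y, y ∂μ‖ₑ ^ 2 ∂μ

lemma W2sq_mixture_dirac_ne_top [BorelSpace E] [SecondCountableTopology E] {K₀ K₁ : ℕ}
    {π₀ : Fin K₀ → ℝ} (hπ₀ : π₀ ∈ stdSimplex ℝ (Fin K₀))
    {π₁ : Fin K₁ → ℝ} (hπ₁ : π₁ ∈ stdSimplex ℝ (Fin K₁)) (m₀ : Fin K₀ → E) (m₁ : Fin K₁ → E) :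
    W2sq (mixture π₀ fun k ↦ Measure.dirac (m₀ k))
      (mixture π₁ fun k ↦ Measure.dirac (m₁ k)) ≠ ∞ := by
  set μ₀ := mixture π₀ fun k ↦ Measure.dirac (m₀ k)
  set μ₁ := mixture π₁ fun k ↦ Measure.dirac (m₁ k)
  have : IsProbabilityMeasure μ₀ := isProbabilityMeasure_mixture hπ₀ _
  have : IsProbabilityMeasure μ₁ := isProbabilityMeasure_mixture hπ₁ _
  have hprod : quadCost (μ₀.prod μ₁) ≠ ∞ := by
    rw [quadCost, lintegral_prod _ (by fun_prop)]
    simp_rw [μ₀, μ₁, lintegral_mixture, lintegral_dirac]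
    exact ENNReal.sum_ne_top.2 fun k _ ↦ ENNReal.mul_ne_top ENNReal.ofReal_ne_top <|
      ENNReal.sum_ne_top.2 fun l _ ↦ ENNReal.mul_ne_top ENNReal.ofReal_ne_top (by simp)
  exact ne_top_of_le_ne_top hprod (iInf₂_le _ ⟨by simp, by simp⟩)

end Cost

section Hilbert

variable {E : Type*} [NormedAddCommGroup E] [InnerProductSpace ℝ E] [CompleteSpace E]
  [MeasurableSpace E]

lemma lintegral_enorm_sub_sq {μ : Measure E} [IsProbabilityMeasure μ] (hμ : MemLp id 2 μ) (c : E) :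
    ∫⁻ x, ‖x - c‖ₑ ^ 2 ∂μ = ‖(∫ x, x ∂μ) - c‖ₑ ^ 2 + totalVariance μ := by
  set m := ∫ x, x ∂μ with hm
  have hint : Integrable (fun x : E ↦ x) μ := hμ.integrable one_le_two
  have hL2 (a : E) : MemLp (fun x ↦ x - a) 2 μ := hμ.sub (memLp_const a)
  have hcentered : Integrable (fun x ↦ x - m) μ := hint.sub (integrable_const m)
  have hcross : ∫ x, inner ℝ (m - c) (x - m) ∂μ = 0 := by
    rw [integral_inner hcentered, integral_sub hint (integrable_const m), ← hm]
    simp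
  have hexpand : ∫ x, ‖x - c‖ ^ 2 ∂μ = ‖m - c‖ ^ 2 + ∫ x, ‖x - m‖ ^ 2 ∂μ := by
    calc ∫ x, ‖x - c‖ ^ 2 ∂μ
        = ∫ x, (‖m - c‖ ^ 2 + 2 * inner ℝ (m - c) (x - m) + ‖x - m‖ ^ 2) ∂μ := by
          simp_rw [← norm_add_sq_real, add_comm (m - c), sub_add_sub_cancel]
      _ = ‖m - c‖ ^ 2 + ∫ x, ‖x - m‖ ^ 2 ∂μ := by
          have hinner : Integrable (fun x ↦ 2 * inner ℝ (m - c) (x - m)) μ :=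
            (hcentered.const_inner (m - c)).const_mul 2
          have hfirst : Integrable (fun x ↦ ‖m - c‖ ^ 2 + 2 * inner ℝ (m - c) (x - m)) μ :=
            (integrable_const _).add hinner
          rw [integral_add hfirst (hL2 m).norm.integrable_sq,
            integral_add (integrable_const _) hinner, integral_const_mul, hcross]
          simp
  rw [← ofReal_integral_norm_sq (hL2 c), hexpand, ENNReal.ofReal_add (by positivity)
    (integral_nonneg fun _ ↦ sq_nonneg _), ofReal_integral_norm_sq (hL2 m),
    ENNReal.ofReal_pow (norm_nonneg _), ofReal_norm, totalVariance]

variable [BorelSpace E] [SecondCountableTopology E] {K : ℕ}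

lemma quadCost_prod {ν : Measure E} [IsProbabilityMeasure ν] (hν : MemLp id 2 ν) (ρ : Measure E)
    [IsProbabilityMeasure ρ] :
    quadCost (ν.prod ρ) =
      quadCost ((Measure.dirac (∫ x, x ∂ν)).prod ρ) + totalVariance ν := by
  rw [quadCost, quadCost, lintegral_prod_symm _ (by fun_prop), lintegral_prod_symm _ (by fun_prop)]
  simp_rw [lintegral_dirac, lintegral_enorm_sub_sq hν]
  rw [lintegral_add_right _ measurable_const, lintegral_const, measure_univ, mul_one]

lemma quadCost_of_map_snd_eq_dirac {γ : Measure (E × E)} [IsProbabilityMeasure γ]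
    (hγ : MemLp id 2 γ) {y : E} (hy : γ.map Prod.snd = Measure.dirac y) :
    quadCost γ = quadCost (Measure.dirac (∫ p, p ∂γ)) + totalVariance (γ.map Prod.fst) := by
  have hint : Integrable (fun p : E × E ↦ p) γ := hγ.integrable one_le_two
  have hfst : ∫ x, x ∂(γ.map Prod.fst) = (∫ p, p ∂γ).1 :=
    (ContinuousLinearMap.fst ℝ E E).integral_id_map hint
  have hsnd : y = (∫ p, p ∂γ).2 := by
    rw [← integral_dirac (fun x ↦ x) y, ← hy]
    exact (ContinuousLinearMap.snd ℝ E E).integral_id_map hint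
  have hae : ∀ᵐ p ∂γ, p.2 = y := by
    refine ae_of_ae_map (p := (· = y)) measurable_snd.aemeasurable ?_
    simp [hy, ae_dirac_eq]
  have : IsProbabilityMeasure (γ.map Prod.fst) :=
    Measure.isProbabilityMeasure_map measurable_fst.aemeasurable
  have hfstL2 : MemLp id 2 (γ.map Prod.fst) :=
    (memLp_map_measure_iff (by fun_prop) (by fun_prop)).2 hγ.fst
  calc quadCost γ
      = ∫⁻ p, ‖p.1 - y‖ₑ ^ 2 ∂γ := lintegral_congr_ae (hae.mono fun p hp ↦ by simp only [hp])
    _ = ∫⁻ x, ‖x - y‖ₑ ^ 2 ∂(γ.map Prod.fst) := by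
        rw [lintegral_map (by fun_prop) measurable_fst]
    _ = quadCost (Measure.dirac (∫ p, p ∂γ)) + totalVariance (γ.map Prod.fst) := by
        rw [lintegral_enorm_sub_sq hfstL2, hfst, hsnd, quadCost, lintegral_dirac]

lemma lintegral_enorm_sq_mixture (π : Fin K → ℝ) {ν : Fin K → Measure E}
    [∀ k, IsProbabilityMeasure (ν k)] (hν : ∀ k, MemLp id 2 (ν k)) :
    ∫⁻ x, ‖x‖ₑ ^ 2 ∂(mixture π ν) =
      ∫⁻ x, ‖x‖ₑ ^ 2 ∂(mixture π fun k ↦ Measure.dirac (∫ x, x ∂(ν k))) +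
        ∑ k, ENNReal.ofReal (π k) * totalVariance (ν k) := by
  have hcomponent (k : Fin K) :
      ∫⁻ x, ‖x‖ₑ ^ 2 ∂(ν k) = ‖∫ x, x ∂(ν k)‖ₑ ^ 2 + totalVariance (ν k) := by
    simpa only [sub_zero] using lintegral_enorm_sub_sq (hν k) 0
  simp only [lintegral_mixture, lintegral_dirac, hcomponent, mul_add, Finset.sum_add_distrib]

lemma sum_totalVariance_eq_of_mixture_eq {K' : ℕ} {π : Fin K → ℝ} (hπ : ∀ k, 0 ≤ π k)
    {ν : Fin K → Measure E} [∀ k, IsGaussian (ν k)] {π' : Fin K' → ℝ} (hπ' : ∀ k, 0 ≤ π' k)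
    {ν' : Fin K' → Measure E} [∀ k, IsGaussian (ν' k)] (h : mixture π ν = mixture π' ν') :
    ∑ k, ENNReal.ofReal (π k) * totalVariance (ν k) =
      ∑ k, ENNReal.ofReal (π' k) * totalVariance (ν' k) := by
  have hmoment : ∫⁻ x, ‖x‖ₑ ^ 2 ∂(mixture π ν) = ∫⁻ x, ‖x‖ₑ ^ 2 ∂(mixture π' ν') := by rw [h]
  rw [lintegral_enorm_sq_mixture π fun k ↦ IsGaussian.memLp_two_id,
    lintegral_enorm_sq_mixture π' fun k ↦ IsGaussian.memLp_two_id,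
    ← mixture_dirac_mean_eq_of_mixture_eq hπ hπ' h] at hmoment
  refine (ENNReal.add_right_inj ?_).1 hmoment
  simp_rw [lintegral_mixture, lintegral_dirac]
  exact ENNReal.sum_ne_top.2 fun k _ ↦ ENNReal.mul_ne_top ENNReal.ofReal_ne_top (by simp)

theorem MW2sq_mixture_le {K₀ K₁ : ℕ} {π₀ : Fin K₀ → ℝ} (hπ₀ : π₀ ∈ stdSimplex ℝ (Fin K₀))
    (ν₀ : Fin K₀ → Measure E) [∀ k, IsGaussian (ν₀ k)] (π₁ : Fin K₁ → ℝ) (m₁ : Fin K₁ → E) :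
    MW2sq (mixture π₀ ν₀) (mixture π₁ fun k ↦ Measure.dirac (m₁ k)) ≤
      W2sq (mixture π₀ fun k ↦ Measure.dirac (∫ x, x ∂(ν₀ k)))
        (mixture π₁ fun k ↦ Measure.dirac (m₁ k)) +
        ∑ k, ENNReal.ofReal (π₀ k) * totalVariance (ν₀ k) := by
  classical
  rw [W2sq, ENNReal.iInf₂_add]
  refine le_iInf₂ fun γ ⟨hfst, hsnd⟩ ↦ ?_
  have : IsFiniteMeasure (γ.map Prod.fst) := hfst ▸ inferInstance
  have : IsFiniteMeasure γ := Measure.isFiniteMeasure_of_map measurable_fst.aemeasurable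
  obtain ⟨κ, hκ, rfl⟩ := exists_eq_mixture_dirac_prod hfst
  have hκ_mixture : mixture π₀ κ = mixture π₁ fun k ↦ Measure.dirac (m₁ k) := by
    simpa [map_mixture _ _ measurable_snd] using hsnd
  have hfinite : ∀ᵐ y ∂(mixture π₀ κ), y ∈ Finset.univ.image m₁ := by
    rw [hκ_mixture, ae_mixture_iff]
    exact fun k _ ↦ by simp [ae_dirac_eq]
  have hcost : quadCost (mixture π₀ fun k ↦ (ν₀ k).prod (κ k)) =
      quadCost (mixture π₀ fun k ↦ (Measure.dirac (∫ x, x ∂(ν₀ k))).prod (κ k)) +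
        ∑ k, ENNReal.ofReal (π₀ k) * totalVariance (ν₀ k) := by
    have hcomponent (k : Fin K₀) := quadCost_prod (ν := ν₀ k) IsGaussian.memLp_two_id (κ k)
    simp only [quadCost_mixture, hcomponent, mul_add, Finset.sum_add_distrib]
  rw [← hcost]
  refine iInf₂_le _ ⟨⟨?_, ?_⟩, isGaussianMixture_mixture_prod hπ₀ ν₀ κ hfinite⟩
  · simp [map_mixture _ _ measurable_fst]
  · simp [map_mixture _ _ measurable_snd, hκ_mixture]

lemma quadCost_mixture_of_map_snd_ae_mem_countable (π : Fin K → ℝ) {ν : Fin K → Measure (E × E)}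
    [∀ k, IsGaussian (ν k)] {s : Set E} (hs : s.Countable)
    (h : ∀ᵐ y ∂((mixture π ν).map Prod.snd), y ∈ s) :
    quadCost (mixture π ν) = quadCost (mixture π fun k ↦ Measure.dirac (∫ p, p ∂(ν k))) +
      ∑ k, ENNReal.ofReal (π k) * totalVariance ((ν k).map Prod.fst) := by
  rw [map_mixture _ _ measurable_snd, ae_mixture_iff] at h
  rw [quadCost_mixture, quadCost_mixture, ← Finset.sum_add_distrib]
  refine Finset.sum_congr rfl fun k _ ↦ ?_
  rcases le_or_gt (π k) 0 with hk | hk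
  · simp [ENNReal.ofReal_of_nonpos hk]
  · have : IsGaussian ((ν k).map Prod.snd) :=
      inferInstanceAs (IsGaussian ((ν k).map (ContinuousLinearMap.snd ℝ E E)))
    rw [quadCost_of_map_snd_eq_dirac IsGaussian.memLp_two_id
      (eq_dirac_mean_of_ae_mem_countable _ hs (h k hk)), mul_add]

theorem le_MW2sq_mixture {K₀ K₁ : ℕ} {π₀ : Fin K₀ → ℝ} (hπ₀ : ∀ k, 0 ≤ π₀ k)
    (ν₀ : Fin K₀ → Measure E) [∀ k, IsGaussian (ν₀ k)] {π₁ : Fin K₁ → ℝ} (hπ₁ : ∀ k, 0 ≤ π₁ k)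
    (m₁ : Fin K₁ → E) :
    W2sq (mixture π₀ fun k ↦ Measure.dirac (∫ x, x ∂(ν₀ k)))
        (mixture π₁ fun k ↦ Measure.dirac (m₁ k)) +
        ∑ k, ENNReal.ofReal (π₀ k) * totalVariance (ν₀ k) ≤
      MW2sq (mixture π₀ ν₀) (mixture π₁ fun k ↦ Measure.dirac (m₁ k)) := by
  refine le_iInf₂ fun γ ⟨hγ, K, π, ν, hπ, hν, hγ_eq⟩ ↦ ?_
  subst hγ_eq
  have hsupport : ∀ᵐ y ∂((mixture π ν).map Prod.snd), y ∈ Set.range m₁ := by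
    rw [hγ.2, ae_mixture_iff]
    exact fun k _ ↦ by simp [ae_dirac_eq]
  have (k : Fin K) : IsGaussian ((ν k).map Prod.fst) :=
    inferInstanceAs (IsGaussian ((ν k).map (ContinuousLinearMap.fst ℝ E E)))
  rw [quadCost_mixture_of_map_snd_ae_mem_countable π (Set.countable_range m₁) hsupport,
    sum_totalVariance_eq_of_mixture_eq hπ.1 hπ₀ ((map_mixture _ _ measurable_fst).symm.trans hγ.1)]
  gcongr
  refine iInf₂_le _ ?_
  simpa only [integral_dirac] using mixture_dirac_mean_mem_couplings hπ.1 hπ₀ hπ₁ hγ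

end Hilbert

section MultivariateGaussian

variable {ι : Type*} [Fintype ι] [DecidableEq ι]

lemma totalVariance_multivariateGaussian (m : EuclideanSpace ℝ ι) {S : Matrix ι ι ℝ}
    (hS : S.PosSemidef) :
    totalVariance (multivariateGaussian m S) = ENNReal.ofReal S.trace := by
  have hL2 : MemLp (fun x : EuclideanSpace ℝ ι ↦ x - m) 2 (multivariateGaussian m S) :=
    IsGaussian.memLp_two_id.sub (memLp_const m)
  rw [totalVariance, integral_id_multivariateGaussian, ← ofReal_integral_norm_sq hL2]
  congr 1
  calc ∫ x, ‖x - m‖ ^ 2 ∂(multivariateGaussian m S)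
      = ∑ i, ∫ x, (x i - m i) ^ 2 ∂(multivariateGaussian m S) := by
        simp_rw [EuclideanSpace.real_norm_sq_eq]
        refine integral_finsetSum _ fun i _ ↦ ?_
        exact ((EuclideanSpace.proj (𝕜 := ℝ) i).comp_memLp' hL2).integrable_sq
    _ = ∑ i, Var[fun x ↦ x i; multivariateGaussian m S] := by
        refine Finset.sum_congr rfl fun i _ ↦ ?_
        have hmean : ∫ x, x i ∂(multivariateGaussian m S) = m i := by
          have h := (EuclideanSpace.proj (𝕜 := ℝ) i).integral_comp_comm
            (IsGaussian.integrable_fun_id (μ := multivariateGaussian m S))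
          rw [integral_id_multivariateGaussian] at h
          exact h
        rw [variance_eq_integral (by fun_prop), hmean]
    _ = S.trace := Finset.sum_congr rfl fun i _ ↦ variance_eval_multivariateGaussian hS i

lemma sum_totalVariance_multivariateGaussian {K : ℕ} {π : Fin K → ℝ} (hπ : ∀ k, 0 ≤ π k)
    (m : Fin K → EuclideanSpace ℝ ι) {S : Fin K → Matrix ι ι ℝ} (hS : ∀ k, (S k).PosSemidef) :
    ∑ k, ENNReal.ofReal (π k) * totalVariance (multivariateGaussian (m k) (S k)) =
      ENNReal.ofReal (∑ k, π k * (S k).trace) := by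
  rw [ENNReal.ofReal_sum_of_nonneg fun k _ ↦ mul_nonneg (hπ k) (hS k).trace_nonneg]
  simp only [totalVariance_multivariateGaussian _ (hS _), ENNReal.ofReal_mul (hπ _)]

end MultivariateGaussian

end GMMTransport

theorem mainTheorem9_general {E : Type*} [NormedAddCommGroup E] [InnerProductSpace ℝ E]
    [CompleteSpace E] [SecondCountableTopology E] [MeasurableSpace E] [BorelSpace E] {K₀ K₁ : ℕ}
    (π₀ : Fin K₀ → ℝ) (hπ₀ : π₀ ∈ stdSimplex ℝ (Fin K₀))
    (π₁ : Fin K₁ → ℝ) (hπ₁ : π₁ ∈ stdSimplex ℝ (Fin K₁))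
    (ν₀ : Fin K₀ → Measure E) [∀ k, IsGaussian (ν₀ k)] (m₁ : Fin K₁ → E) :
    GMMTransport.W2sq
        (GMMTransport.mixture π₀ fun k ↦ Measure.dirac (∫ x, x ∂(ν₀ k)))
        (GMMTransport.mixture π₁ fun k ↦ Measure.dirac (m₁ k)) ≠ ∞ ∧
    GMMTransport.MW2sq
        (GMMTransport.mixture π₀ ν₀)
        (GMMTransport.mixture π₁ fun k ↦ Measure.dirac (m₁ k)) =
      GMMTransport.W2sq
          (GMMTransport.mixture π₀ fun k ↦ Measure.dirac (∫ x, x ∂(ν₀ k)))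
          (GMMTransport.mixture π₁ fun k ↦ Measure.dirac (m₁ k)) +
        ∑ k, ENNReal.ofReal (π₀ k) * GMMTransport.totalVariance (ν₀ k) :=
  ⟨GMMTransport.W2sq_mixture_dirac_ne_top hπ₀ hπ₁ _ m₁,
    (GMMTransport.MW2sq_mixture_le hπ₀ ν₀ π₁ m₁).antisymm
      (GMMTransport.le_MW2sq_mixture hπ₀.1 ν₀ hπ₁.1 m₁)⟩

theorem mainTheorem9 {d K₀ K₁ : ℕ}
    (π₀ : Fin K₀ → ℝ) (hπ₀ : π₀ ∈ stdSimplex ℝ (Fin K₀))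
    (π₁ : Fin K₁ → ℝ) (hπ₁ : π₁ ∈ stdSimplex ℝ (Fin K₁))
    (m₀ : Fin K₀ → EuclideanSpace ℝ (Fin d))
    (S₀ : Fin K₀ → Matrix (Fin d) (Fin d) ℝ) (hS₀ : ∀ k, (S₀ k).PosSemidef)
    (m₁ : Fin K₁ → EuclideanSpace ℝ (Fin d)) :
    GMMTransport.W2sq
        (GMMTransport.mixture π₀ fun k => Measure.dirac (m₀ k))
        (GMMTransport.mixture π₁ fun k => Measure.dirac (m₁ k)) ≠ ∞ ∧
    GMMTransport.MW2sq
        (GMMTransport.mixture π₀ fun k => multivariateGaussian (m₀ k) (S₀ k))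
        (GMMTransport.mixture π₁ fun k => Measure.dirac (m₁ k)) =
      GMMTransport.W2sq
          (GMMTransport.mixture π₀ fun k => Measure.dirac (m₀ k))
          (GMMTransport.mixture π₁ fun k => Measure.dirac (m₁ k)) +
        ENNReal.ofReal (∑ k, π₀ k * (S₀ k).trace) := by
  simpa only [integral_id_multivariateGaussian,
    GMMTransport.sum_totalVariance_multivariateGaussian hπ₀.1 m₀ hS₀] using
    mainTheorem9_general π₀ hπ₀ π₁ hπ₁ (fun k ↦ multivariateGaussian (m₀ k) (S₀ k)) m₁
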